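/- **Setting.** An instance $(G,<,\mathbf q)$ consists of a finite bipartite graph $G=(A\cup B,E)$ of students $A$ and schools $B$, a strict ordering $<_v$ of the neighbours of every $v\in A\cup B$, and quotas $q_b\in\mathbb N$ $(b\in B)$; moreover a set $\overline A\subseteq A$ of consenting students is given. An assignment is a set $M\subseteq E$ with at most one edge at each $a\in A$ and at most $q_b$ edges at each $b\in B$; $M(a)=\emptyset$ means that $a$ is unassigned, and $b>_a\emptyset$ for all $ab\in E$. We say that $a$ *wants* $b$ (in a graph, at $M$) if $ab$ is an edge of that graph and $b>_a M(a)$. Deleting edges leaves the remaining preferences and the quotas unchanged. To *dismiss* $ab$ means to delete the edge $ab$ and, if $a\notin\overline A$, also all edges $a'b$ with $a>_b a'$. GS denotes the student-proposing Gale–Shapley algorithm: in each step all unmatched students who can do so apply to the first school on their list to which they have not yet applied, and each school keeps its $q_b$ best candidates and rejects the others. **School-rotate-remove with consent.** The school-rotation digraph of $M$ in $G$ has vertex set $A\cup B\cup\{\emptyset\}$; for every school $b$ for which some student outside $M(b)$ wants $b$, let $s_M(b)$ be the first such student on the list of $b$; then $(b,s_M(b))$ and $(s_M(b),M(s_M(b)))$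 are arcs. Start with the input graph and $M=$ its GS assignment. While the digraph of the current $M$ in the current graph has an arc, choose arbitrarily either (i) arcs $(b',a),(a,v)$ such that $v\in B\cup\{\emptyset\}$ is a sink, and dismiss $ab'$; or (ii) a directed cycle $b_0,a_1,b_1,\dots,b_{r-1},a_0$ (indices mod $r$), and replace $M$ by the assignment in which $a_{i+1}$ is assigned to $b_i$ for all $i$ and all other students are assigned as before. When there is no arc, output $M$. **Simplified EADAM.** Start with the input graph. Repeat: let $M$ be the GS assignment of the current graph, and call a school *underdemanded* if no student wants it in the current graph. If all schools are underdemanded, output $M$. Otherwise, for every student $a$ who is unassigned or assigned to an underdemanded school, and for every $b$ that $a$ wants in the current graph (at $M$), dismiss $ab$; students and schools are processed in an arbitrary order. (That is, $\emptyset$ counts as an underdemanded school.) **Theorem.** For every instance and every set of consenting students there is an assignment $M$ such that every execution of school-rotate-remove with consent halts and outputs $M$, and every execution of simplified EADAM halts and outputs $M$. Moreover, if the variant of simplified EADAM in which only the students assigned to underdemanded schools, and not the unassigned students, are processed in each round has an execution that halts, then it outputs $M$ as well. -/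

import Mathlib

namespace SchoolChoice

/-- An instance `(G, <, q)` of the stable assignment problem with students `A` and schools `B`:
a bipartite graph (`adj a b` says that `ab` is an edge), for every agent a strict ordering of its
neighbours, and a quota for every school. `gtA a b b'` says that `a` strictly prefers `b` to `b'`,
and `gtB b a a'` that `b` strictly prefers `a` to `a'`; these relations only matter on
neighbours. -/
structure Market (A B : Type*) where
  adj : A → B → Prop
  gtA : A → B → B → Prop
  gtB : B → A → A → Prop
  quota : B → ℕ
  gtA_irrefl : ∀ a b, adj a b → ¬ gtA a b b
  gtA_trans : ∀ a b₁ b₂ b₃, adj a b₁ → adj a b₂ → adj a b₃ →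
    gtA a b₁ b₂ → gtA a b₂ b₃ → gtA a b₁ b₃
  gtA_total : ∀ a b₁ b₂, adj a b₁ → adj a b₂ → b₁ ≠ b₂ → gtA a b₁ b₂ ∨ gtA a b₂ b₁
  gtB_irrefl : ∀ b a, adj a b → ¬ gtB b a a
  gtB_trans : ∀ b a₁ a₂ a₃, adj a₁ b → adj a₂ b → adj a₃ b →
    gtB b a₁ a₂ → gtB b a₂ a₃ → gtB b a₁ a₃
  gtB_total : ∀ b a₁ a₂, adj a₁ b → adj a₂ b → a₁ ≠ a₂ → gtB b a₁ a₂ ∨ gtB b a₂ a₁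

namespace Market

variable {A B : Type*}

/-- The instance obtained by deleting the edges `ab` with `R a b`; preferences are the induced
ones and quotas are unchanged. -/
def remove (I : Market A B) (R : A → B → Prop) : Market A B where
  adj a b := I.adj a b ∧ ¬ R a b
  gtA := I.gtA
  gtB := I.gtB
  quota := I.quota
  gtA_irrefl a b h := I.gtA_irrefl a b h.1
  gtA_trans a b₁ b₂ b₃ h₁ h₂ h₃ := I.gtA_trans a b₁ b₂ b₃ h₁.1 h₂.1 h₃.1
  gtA_total a b₁ b₂ h₁ h₂ := I.gtA_total a b₁ b₂ h₁.1 h₂.1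
  gtB_irrefl b a h := I.gtB_irrefl b a h.1
  gtB_trans b a₁ a₂ a₃ h₁ h₂ h₃ := I.gtB_trans b a₁ a₂ a₃ h₁.1 h₂.1 h₃.1
  gtB_total b a₁ a₂ h₁ h₂ := I.gtB_total b a₁ a₂ h₁.1 h₂.1

/-- `M : A → Option B` is an assignment of the instance: `M a` is the school of `a`, and `none`
(the paper's `∅`) if `a` is unassigned. It uses only edges of the graph and respects quotas. -/
def IsAssignment (I : Market A B) (M : A → Option B) : Prop :=
  (∀ a b, M a = some b → I.adj a b) ∧ ∀ b, {a | M a = some b}.ncard ≤ I.quota b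

/-- `ab` is an edge and `b >_a M(a)`, where every neighbour of `a` is preferred to `∅`. -/
def Wants (I : Market A B) (M : A → Option B) (a : A) (b : B) : Prop :=
  I.adj a b ∧ ∀ b', M a = some b' → I.gtA a b b'

/-! ### Student-proposing Gale-Shapley algorithm -/

/-- State of the algorithm: who has already applied where, and the tentative assignment. -/
structure GSState (A B : Type*) where
  applied : A → B → Prop
  held : A → Option B

/-- In the next step, the currently unmatched student `a` applies to `b`, the first school on the
list of `a` to which `a` has not yet applied. -/
def Proposes (I : Market A B) (s : GSState A B) (a : A) (b : B) : Prop :=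
  s.held a = none ∧ I.adj a b ∧ ¬ s.applied a b ∧
    ∀ b', I.adj a b' → ¬ s.applied a b' → b' ≠ b → I.gtA a b b'

/-- `a` is tentatively held by `b` or applies to `b` in the next step. -/
def Candidate (I : Market A B) (s : GSState A B) (b : B) (a : A) : Prop :=
  s.held a = some b ∨ I.Proposes s a b

/-- `a` is among the `q_b` most preferred candidates of `b`. -/
def Accepts (I : Market A B) (s : GSState A B) (b : B) (a : A) : Prop :=
  I.Candidate s b a ∧ {a' | I.Candidate s b a' ∧ I.gtB b a' a}.ncard < I.quota b

/-- One step: all unmatched students with a school left on their list apply simultaneously, and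
every school keeps its best candidates up to its quota and rejects the others. -/
def GSStep (I : Market A B) (s t : GSState A B) : Prop :=
  (∃ a b, I.Proposes s a b) ∧
  (∀ a b, t.applied a b ↔ (s.applied a b ∨ I.Proposes s a b)) ∧
  (∀ a b, t.held a = some b ↔ I.Accepts s b a)

/-- `M` is the output of the student-proposing Gale-Shapley algorithm: it is the tentative
assignment when, starting from no applications, no student can apply any more. -/
def GSOutput (I : Market A B) (M : A → Option B) : Prop :=
  ∃ s : GSState A B, Relation.ReflTransGen I.GSStep ⟨fun _ _ => False, fun _ => none⟩ s ∧
    (¬ ∃ a b, I.Proposes s a b) ∧ s.held = M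

/-! ### School-rotation digraph -/

/-- `s_M(b) = a`: `a ∉ M(b)` is the first student on the list of `b` who prefers `b` to `M(a)`. -/
def IsS (I : Market A B) (M : A → Option B) (b : B) (a : A) : Prop :=
  (M a ≠ some b ∧ I.Wants M a b) ∧
    ∀ a', M a' ≠ some b → I.Wants M a' b → a' ≠ a → I.gtB b a a'

/-- The vertices of the rotation digraph: schools, students, and `∅`. -/
inductive Vertex (A B : Type*)
  | school (b : B)
  | student (a : A)
  | empty

/-- `M(a)` as a vertex. -/
def partner (M : A → Option B) (a : A) : Vertex A B :=
  match M a with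
  | some b => Vertex.school b
  | none => Vertex.empty

/-- The arcs of the school-rotation digraph of `M`: if `s_M(b) = a`, then there are an arc from
`b` to `a` and an arc from `a` to `next_M(b)`, which is `M(a)` (and `∅` if `a` is unassigned),
as students have quota one. -/
inductive Arc (I : Market A B) (M : A → Option B) : Vertex A B → Vertex A B → Prop
  | out (b : B) (a : A) (h : I.IsS M b a) : Arc I M (Vertex.school b) (Vertex.student a)
  | next (b : B) (a : A) (h : I.IsS M b a) : Arc I M (Vertex.student a) (partner M a)

/-- A vertex without outgoing arc. In particular `∅` is a sink. -/
def IsSink (I : Market A B) (M : A → Option B) (v : Vertex A B) : Prop :=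
  ∀ w, ¬ I.Arc M v w

/-- `b 0, a 1, b 1, a 2, …, b n, a 0` is a directed cycle of the rotation digraph (indices are
modulo `n + 1`); these cycles are the exposed school-rotations `a 0, b 0, …, a n, b n`. -/
def IsCycle (I : Market A B) (M : A → Option B) {n : ℕ} (a : Fin (n + 1) → A)
    (b : Fin (n + 1) → B) : Prop :=
  Function.Injective a ∧ Function.Injective b ∧
  ∀ i, I.Arc M (Vertex.school (b i)) (Vertex.student (a (i + 1))) ∧
    I.Arc M (Vertex.student (a i)) (Vertex.school (b i))

/-- `M'` arises from `M` by eliminating the rotation: `b i` gives up `a i` and gets `a (i + 1)`. -/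
def IsElimination (M M' : A → Option B) {n : ℕ} (a : Fin (n + 1) → A)
    (b : Fin (n + 1) → B) : Prop :=
  (∀ i, M' (a (i + 1)) = some (b i)) ∧ ∀ x, x ∉ Set.range a → M' x = M x

/-! ### Executions of a nondeterministic algorithm -/

/-- Every execution started in `s₀` halts and outputs `M`: there is no infinite execution, and
whenever an execution cannot be continued, the algorithm has halted with output `M`. -/
def EveryExecutionOutputs {S O : Type*} (step : S → S → Prop) (haltsWith : S → O → Prop)
    (s₀ : S) (M : O) : Prop :=
  (¬ ∃ f : ℕ → S, f 0 = s₀ ∧ ∀ n, step (f n) (f (n + 1))) ∧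
  ∀ s, Relation.ReflTransGen step s₀ s → (∀ t, ¬ step s t) → haltsWith s M

/-- Remove the edge `ab` and, if `a` is not in the set `C` of consenting students, also all edges
`a'b` with `a >_b a'`. -/
def dismiss (I : Market A B) (C : Set A) (a : A) (b : B) : Market A B :=
  I.remove fun a' b' => b' = b ∧ (a' = a ∨ (a ∉ C ∧ I.gtB b a a'))

/-! ### School-rotate-remove with consent -/

/-- One iteration of the while loop, on the current instance and assignment. -/
inductive RRRStep (C : Set A) :
    Market A B × (A → Option B) → Market A B × (A → Option B) → Prop
  /-- Arcs `(b', a)` and `(a, v)` with `v` a sink are found. -/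
  | sink (I : Market A B) (M : A → Option B) (b' : B) (a : A) (v : Vertex A B)
      (h₁ : I.Arc M (Vertex.school b') (Vertex.student a))
      (h₂ : I.Arc M (Vertex.student a) v) (h₃ : I.IsSink M v) :
      RRRStep C (I, M) (I.dismiss C a b', M)
  /-- A directed cycle is found. -/
  | rotation (I : Market A B) (M M' : A → Option B) (n : ℕ) (a : Fin (n + 1) → A)
      (b : Fin (n + 1) → B) (h₁ : I.IsCycle M a b) (h₂ : IsElimination M M' a b) :
      RRRStep C (I, M) (I, M')

/-- The loop ends when the digraph has no arc, and the current assignment is output. -/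
def RRRHaltsWith (s : Market A B × (A → Option B)) (M : A → Option B) : Prop :=
  (∀ v w, ¬ s.1.Arc s.2 v w) ∧ s.2 = M

/-- Every execution of school-rotate-remove with consent, with consenting students `C`, halts
with output `M`. -/
def RRROutputs (I : Market A B) (C : Set A) (M : A → Option B) : Prop :=
  (∃ M₀, I.GSOutput M₀) ∧
  ∀ M₀, I.GSOutput M₀ → EveryExecutionOutputs (RRRStep C) RRRHaltsWith (I, M₀) M

/-! ### Simplified EADAM -/

/-- `b` is underdemanded in `M`: no student strictly prefers `b` to his assignment. -/
def Underdemanded (I : Market A B) (M : A → Option B) (b : B) : Prop :=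
  ∀ a, ¬ I.Wants M a b

/-- The students assigned to underdemanded schools. -/
def assignedUnderdemanded (I : Market A B) (M : A → Option B) : Set A :=
  {a | ∃ b, M a = some b ∧ I.Underdemanded M b}

/-- The students assigned to underdemanded schools, where `∅` counts as a school: no student
prefers `∅` to his assignment, so `∅` is underdemanded and unassigned students belong to the
set. -/
def assignedUnderdemandedOrEmpty (I : Market A B) (M : A → Option B) : Set A :=
  I.assignedUnderdemanded M ∪ {a | M a = none}

open Classical in
/-- The body of the inner for loop, for the student `a` and the school `b`; `G` is the current
graph and `M` the assignment of the current iteration. -/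
noncomputable def settlePair (C : Set A) (M : A → Option B) (a : A) (G : Market A B) (b : B) :
    Market A B :=
  if G.Wants M a b then G.dismiss C a b else G

/-- The nested for loops, where `as` lists the students of the outer loop in some order and
`bs a` lists the schools in the order in which the inner loop for `a` goes through them. -/
noncomputable def settle (C : Set A) (M : A → Option B) (as : List A) (bs : A → List B)
    (G : Market A B) : Market A B :=
  as.foldl (fun G a => (bs a).foldl (settlePair C M a) G) G

/-- One iteration which is not the last one, from the graph `G` to the graph `G'`. The set
`T G M` consists of the students of the outer for loop; they and the schools are processed in an
arbitrary order. -/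
def SEADAMStep (T : Market A B → (A → Option B) → Set A) (C : Set A) (G G' : Market A B) : Prop :=
  ∃ (M : A → Option B) (as : List A) (bs : A → List B),
    G.GSOutput M ∧ (∃ b, ¬ G.Underdemanded M b) ∧
    as.Nodup ∧ (∀ a, a ∈ as ↔ a ∈ T G M) ∧
    (∀ a, (bs a).Nodup ∧ ∀ b, b ∈ bs a) ∧
    G' = settle C M as bs G

/-- The last iteration: all schools are underdemanded in the Gale-Shapley assignment of the
current graph, which is output. -/
def SEADAMHaltsWith (G : Market A B) (M : A → Option B) : Prop :=
  G.GSOutput M ∧ ∀ b, G.Underdemanded M b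

/-- Every execution of simplified EADAM, with consenting students `C`, halts with output `M`. -/
def SEADAMOutputs (I : Market A B) (C : Set A) (M : A → Option B) : Prop :=
  EveryExecutionOutputs (SEADAMStep assignedUnderdemandedOrEmpty C) SEADAMHaltsWith I M

/-- Some execution of the variant of simplified EADAM in which unassigned students are never
settled halts with output `M`. This variant need not halt if there are unassigned students. -/
def NarrowSEADAMHaltsWith (I : Market A B) (C : Set A) (M : A → Option B) : Prop :=
  ∃ G, Relation.ReflTransGen (SEADAMStep assignedUnderdemanded C) I G ∧ SEADAMHaltsWith G M

end Market

end SchoolChoice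

namespace SchoolChoice

/-! ### Selecting the best elements of a finite set -/

/-! Both algorithms rewrite the graph by the same move, `SettleStep`: a student who is settled at a
stable assignment, that is, unassigned or at an underdemanded school, is dismissed from a school
that he wants. Each move deletes an edge, and moves are confluent, so the input graph has exactly
one terminal graph. The common output is the student-optimal stable assignment of that graph.

Confluence rests on counting. An improvement of a stable assignment preserves the set of assigned
students and the size of every school (`Stable.ncard_eq`), so settled students keep their schools
and stay settled (`Stable.eq_of_settled`, `Settled.of_improvedBy`). Hence every move can be
witnessed by the student-optimal assignment (`wants_of_settled`). This assignment stays stable after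
a dismissal, so two moves on the same graph commute, except that one may make the other void
(`SettleStep.confluent`).

In school-rotate-remove, a path into a sink gives a move, and a rotation keeps the graph and
improves the stable assignment (`IsElimination.stable`). A round of simplified EADAM is a sequence
of moves witnessed by one fixed assignment. When nobody wants a school at a stable assignment, that
assignment is student-optimal and no move exists, so the graph is the terminal one.

For halting, a wanted school always leads to a sink or a cycle (`Wants.exists_sink_or_cycle`). Each
step of school-rotate-remove reduces the set of wanting pairs. Student-optimal assignments have no
cycle, so every EADAM round finds a sink and loses an edge. -/

theorem ncard_Iio (q : ℕ) : (Set.Iio q).ncard = q := by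
  rw [Set.ncard_eq_toFinset_card', Set.toFinset_Iio, Nat.card_Iio]

section Selection

variable {A : Type*} [Finite A] {S : Set A} {r : A → A → Prop}

theorem ncard_above_lt (hi : ∀ x ∈ S, ¬ r x x)
    (ht : ∀ x ∈ S, ∀ y ∈ S, ∀ z ∈ S, r x y → r y z → r x z) {x y : A} (hx : x ∈ S) (hy : y ∈ S)
    (h : r x y) : {z | z ∈ S ∧ r z x}.ncard < {z | z ∈ S ∧ r z y}.ncard := by
  refine Set.ncard_lt_ncard ⟨fun z hz => ⟨hz.1, ht z hz.1 x hx y hy hz.2 h⟩, fun hs => ?_⟩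
    (Set.toFinite _)
  exact hi x hx (hs (show x ∈ {z | z ∈ S ∧ r z y} from ⟨hx, h⟩)).2

theorem ncard_above_injOn (hi : ∀ x ∈ S, ¬ r x x)
    (ht : ∀ x ∈ S, ∀ y ∈ S, ∀ z ∈ S, r x y → r y z → r x z)
    (htot : ∀ x ∈ S, ∀ y ∈ S, x ≠ y → r x y ∨ r y x) :
    Set.InjOn (fun x => {z | z ∈ S ∧ r z x}.ncard) S := by
  intro x hx y hy hxy
  by_contra hne
  rcases htot x hx y hy hne with h | h
  · exact (ncard_above_lt hi ht hx hy h).ne hxy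
  · exact (ncard_above_lt hi ht hy hx h).ne hxy.symm

theorem ncard_best_le (hi : ∀ x ∈ S, ¬ r x x)
    (ht : ∀ x ∈ S, ∀ y ∈ S, ∀ z ∈ S, r x y → r y z → r x z)
    (htot : ∀ x ∈ S, ∀ y ∈ S, x ≠ y → r x y ∨ r y x) (q : ℕ) :
    {x | x ∈ S ∧ {z | z ∈ S ∧ r z x}.ncard < q}.ncard ≤ q := by
  have h := Set.ncard_le_ncard_of_injOn (s := {x | x ∈ S ∧ {z | z ∈ S ∧ r z x}.ncard < q})
    (t := Set.Iio q) (fun x => {z | z ∈ S ∧ r z x}.ncard) (fun x hx => hx.2)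
    ((ncard_above_injOn hi ht htot).mono fun x hx => hx.1) (Set.finite_Iio q)
  rwa [ncard_Iio] at h

/-- The rank of an element, the number of elements above it, is injective on `S` with values below
`S.ncard`. All these values therefore occur, in particular those below `q`. -/
theorem le_ncard_best (hi : ∀ x ∈ S, ¬ r x x)
    (ht : ∀ x ∈ S, ∀ y ∈ S, ∀ z ∈ S, r x y → r y z → r x z)
    (htot : ∀ x ∈ S, ∀ y ∈ S, x ≠ y → r x y ∨ r y x) {q : ℕ} (hq : q ≤ S.ncard) :
    q ≤ {x | x ∈ S ∧ {z | z ∈ S ∧ r z x}.ncard < q}.ncard := by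
  set ρ : A → ℕ := fun x => {z | z ∈ S ∧ r z x}.ncard with hρ
  have hsub : ρ '' S ⊆ Set.Iio S.ncard := by
    rintro _ ⟨x, hx, rfl⟩
    exact Set.ncard_lt_ncard ⟨fun z hz => hz.1, fun hs => hi x hx (hs hx).2⟩ (Set.toFinite _)
  have heq : ρ '' S = Set.Iio S.ncard := by
    refine Set.eq_of_subset_of_ncard_le hsub ?_ (Set.finite_Iio _)
    rw [(ncard_above_injOn hi ht htot).ncard_image,
      ncard_Iio]
  have hq' : Set.Iio q ⊆ ρ '' {x | x ∈ S ∧ ρ x < q} := by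
    intro k hk
    have : k ∈ ρ '' S := heq ▸ (lt_of_lt_of_le hk hq : k < S.ncard)
    obtain ⟨x, hx, rfl⟩ := this
    exact ⟨x, ⟨hx, hk⟩, rfl⟩
  calc q = (Set.Iio q).ncard := (ncard_Iio q).symm
    _ ≤ (ρ '' {x | x ∈ S ∧ ρ x < q}).ncard := Set.ncard_le_ncard hq' (Set.toFinite _)
    _ ≤ _ := Set.ncard_image_le (Set.toFinite _)

theorem rel_of_not_best (hi : ∀ x ∈ S, ¬ r x x)
    (ht : ∀ x ∈ S, ∀ y ∈ S, ∀ z ∈ S, r x y → r y z → r x z)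
    (htot : ∀ x ∈ S, ∀ y ∈ S, x ≠ y → r x y ∨ r y x) {q : ℕ} {x y : A} (hx : x ∈ S)
    (hxq : q ≤ {z | z ∈ S ∧ r z x}.ncard) (hy : y ∈ S)
    (hyq : {z | z ∈ S ∧ r z y}.ncard < q) : r y x := by
  have hne : y ≠ x := by rintro rfl; omega
  rcases htot y hy x hx hne with h | h
  · exact h
  · have := ncard_above_lt hi ht hx hy h
    omega

theorem exists_rel_all (hi : ∀ x ∈ S, ¬ r x x)
    (ht : ∀ x ∈ S, ∀ y ∈ S, ∀ z ∈ S, r x y → r y z → r x z)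
    (htot : ∀ x ∈ S, ∀ y ∈ S, x ≠ y → r x y ∨ r y x) (hS : S.Nonempty) :
    ∃ x ∈ S, ∀ y ∈ S, y ≠ x → r x y := by
  obtain ⟨x, hx, hmin⟩ := Set.exists_min_image S (fun x => {z | z ∈ S ∧ r z x}.ncard)
    (Set.toFinite _) hS
  refine ⟨x, hx, fun y hy hne => ?_⟩
  rcases htot y hy x hx hne with h | h
  · exact absurd (ncard_above_lt hi ht hy hx h) (hmin y hy).not_gt
  · exact h

end Selection

namespace Market

variable {A B : Type*}

/-! ### Stable assignments and Pareto improvements -/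

/-- A stable assignment: every school which is wanted by a student is full, and it prefers all
its students to him. -/
def Stable (I : Market A B) (M : A → Option B) : Prop :=
  I.IsAssignment M ∧ ∀ a b, I.Wants M a b →
    I.quota b ≤ {a' | M a' = some b}.ncard ∧ ∀ a', M a' = some b → I.gtB b a' a

/-- Every student who is treated differently in `N` wants his school of `N` at `M`. -/
def ImprovedBy (I : Market A B) (M N : A → Option B) : Prop :=
  ∀ a, N a = M a ∨ ∃ b, N a = some b ∧ I.Wants M a b

/-- `M` is stable and all students like it at least as much as any stable assignment. -/
def IsOptimal (I : Market A B) (M : A → Option B) : Prop :=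
  I.Stable M ∧ ∀ N, I.Stable N → I.ImprovedBy N M

theorem Wants.ne {I : Market A B} {M : A → Option B} {a : A} {b : B} (h : I.Wants M a b) :
    M a ≠ some b := fun hM => I.gtA_irrefl a b h.1 (h.2 b hM)

theorem gtB_asymm {I : Market A B} {b : B} {a a' : A} (h : I.adj a b) (h' : I.adj a' b)
    (hg : I.gtB b a a') : ¬ I.gtB b a' a :=
  fun hg' => I.gtB_irrefl b a h (I.gtB_trans b a a' a h h' h hg hg')

theorem gtA_asymm {I : Market A B} {a : A} {b b' : B} (h : I.adj a b) (h' : I.adj a b')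
    (hg : I.gtA a b b') : ¬ I.gtA a b' b :=
  fun hg' => I.gtA_irrefl a b h (I.gtA_trans a b b' b h h' h hg hg')

/-- By transitivity, improvements only shrink the set of wanting pairs. Underdemanded schools thus
stay underdemanded. -/
theorem ImprovedBy.wants {I : Market A B} {M N : A → Option B} (h : I.ImprovedBy M N)
    (hM : I.IsAssignment M) {a : A} {b : B} (hw : I.Wants N a b) : I.Wants M a b := by
  rcases h a with h | ⟨b₁, h₁, hw₁⟩
  · exact ⟨hw.1, fun b' hb' => hw.2 b' (h.trans hb')⟩
  · exact ⟨hw.1, fun b' hb' => I.gtA_trans a b b₁ b' hw.1 hw₁.1 (hM.1 a b' hb') (hw.2 b₁ h₁)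
      (hw₁.2 b' hb')⟩

theorem ImprovedBy.antisymm {I : Market A B} {M N : A → Option B} (hM : I.IsAssignment M)
    (h : I.ImprovedBy M N) (h' : I.ImprovedBy N M) : M = N := by
  funext a
  rcases h' a with h₁ | ⟨b, hb, hw⟩
  · exact h₁
  · exact absurd hb (h.wants hM hw).ne

theorem IsOptimal.eq {I : Market A B} {M N : A → Option B} (hM : I.IsOptimal M)
    (hN : I.IsOptimal N) : M = N :=
  ImprovedBy.antisymm hM.1.1 (hN.2 M hM.1) (hM.2 N hN.1)

theorem sum_ncard_eq [Finite A] [Fintype B] (M : A → Option B) :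
    ∑ b, {a | M a = some b}.ncard = {a | M a ≠ none}.ncard := by
  classical
  have := Fintype.ofFinite A
  have h := Finset.card_eq_sum_card_fiberwise (s := Finset.univ.filter fun a => M a ≠ none)
    (t := (Finset.univ : Finset B).image some) (f := M) (by
      intro a ha
      have ha' : M a ≠ none := by simpa using ha
      obtain ⟨b, hb⟩ := Option.ne_none_iff_exists'.1 ha'
      simp [hb])
  rw [Set.ncard_eq_toFinset_card', Set.toFinset_ofPred, h,
    Finset.sum_image fun x _ y _ hxy => Option.some_injective _ hxy]
  refine Finset.sum_congr rfl fun b _ => ?_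
  rw [Set.ncard_eq_toFinset_card', Set.toFinset_ofPred, Finset.filter_filter]
  congr 1
  ext a
  simp only [Finset.mem_filter, Finset.mem_univ, true_and]
  constructor
  · intro h; simp [h]
  · exact fun h => h.2

/-- Improving a stable assignment changes neither the set of assigned students nor the number of
students of any school. -/
theorem Stable.ncard_eq [Finite A] [Finite B] {I : Market A B} {M N : A → Option B}
    (hM : I.Stable M) (hN : I.IsAssignment N) (h : I.ImprovedBy M N) :
    (∀ a, M a = none → N a = none) ∧
      ∀ b, {a | N a = some b}.ncard = {a | M a = some b}.ncard := by
  have := Fintype.ofFinite B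
  have hle : ∀ b, {a | N a = some b}.ncard ≤ {a | M a = some b}.ncard := by
    intro b
    by_cases hs : {a | N a = some b} ⊆ {a | M a = some b}
    · exact Set.ncard_le_ncard hs (Set.toFinite _)
    -- A school that gains a student was wanted at `M`, hence already full.
    · obtain ⟨a, ha, ha'⟩ := Set.not_subset.1 hs
      rcases h a with h₁ | ⟨b₁, h₁, hw⟩
      · exact absurd (h₁.symm.trans ha) ha'
      · obtain rfl : b₁ = b := Option.some_injective _ (h₁.symm.trans ha)
        exact (hN.2 b₁).trans (hM.2 a b₁ hw).1
  have hsub : {a | M a ≠ none} ⊆ {a | N a ≠ none} := by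
    intro a ha hn
    rcases h a with h₁ | ⟨b₁, h₁, -⟩
    · exact ha (h₁.symm.trans hn)
    · exact absurd (hn.symm.trans h₁) (by simp)
  have hsum : ∑ b, {a | N a = some b}.ncard ≤ ∑ b, {a | M a = some b}.ncard :=
    Finset.sum_le_sum fun b _ => hle b
  -- No school grows and no student loses his place, while both counts give the same total; so all
  -- the inequalities are equalities.
  have hsupp := Set.eq_of_subset_of_ncard_le hsub
    (by rw [← sum_ncard_eq, ← sum_ncard_eq]; exact hsum) (Set.toFinite _)
  refine ⟨fun a ha => ?_, fun b => ?_⟩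
  · by_contra hn
    have : a ∈ {a | M a ≠ none} := hsupp ▸ hn
    exact this ha
  · refine (Finset.sum_eq_sum_iff_of_le fun b _ => hle b).1 (le_antisymm hsum ?_) b
      (Finset.mem_univ b)
    rw [sum_ncard_eq, sum_ncard_eq, hsupp]

/-! ### Settled students under improvements -/

/-- The school of `a` (possibly `∅`) is underdemanded. -/
def Settled (I : Market A B) (M : A → Option B) (a : A) : Prop :=
  ∀ b, M a = some b → I.Underdemanded M b

/-- An underdemanded school gains nobody in an improvement, and its size is preserved, so it also
loses nobody. -/
theorem Stable.eq_of_settled [Finite A] [Finite B] {I : Market A B} {M N : A → Option B}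
    (hM : I.Stable M) (hN : I.IsAssignment N) (h : I.ImprovedBy M N) {a : A}
    (ha : I.Settled M a) : N a = M a := by
  obtain ⟨h₀, h₁⟩ := hM.ncard_eq hN h
  rcases hMa : M a with _ | b
  · exact h₀ a hMa
  · have hs : {a | N a = some b} ⊆ {a | M a = some b} := by
      intro c hc
      rcases h c with h₂ | ⟨b₂, h₂, hw⟩
      · exact h₂.symm.trans hc
      · obtain rfl : b₂ = b := Option.some_injective _ (h₂.symm.trans hc)
        exact absurd hw (ha b₂ hMa c)
    have heq := Set.eq_of_subset_of_ncard_le hs (h₁ b).ge (Set.toFinite _)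
    have : a ∈ {a | N a = some b} := heq ▸ hMa
    exact this

theorem Settled.of_improvedBy [Finite A] [Finite B] {I : Market A B} {M N : A → Option B}
    (hM : I.Stable M) (hN : I.IsAssignment N) (h : I.ImprovedBy M N) {a : A}
    (ha : I.Settled M a) : I.Settled N a := by
  intro b hb c hc
  rw [hM.eq_of_settled hN h ha] at hb
  exact ha b hb c (h.wants hM.1 hc)

/-! ### The Gale-Shapley algorithm -/

/-- What holds in every state of the algorithm. -/
structure GSInvariant (I : Market A B) (s : GSState A B) : Prop where
  adj : ∀ a b, s.applied a b → I.adj a b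
  held : ∀ a b, s.held a = some b → s.applied a b
  upward : ∀ a b b', s.applied a b → I.adj a b' → I.gtA a b' b → s.applied a b'
  quota : ∀ b, {a | s.held a = some b}.ncard ≤ I.quota b
  rejected : ∀ a b, s.applied a b → s.held a ≠ some b →
    I.quota b ≤ {a' | s.held a' = some b}.ncard ∧ ∀ a', s.held a' = some b → I.gtB b a' a
  achievable : ∀ N, I.Stable N → ∀ a b, s.applied a b → N a = some b → s.held a = some b

theorem Proposes.unique {I : Market A B} {s : GSState A B} {a : A} {b b' : B}
    (h : I.Proposes s a b) (h' : I.Proposes s a b') : b = b' := by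
  by_contra hne
  exact gtA_asymm h.2.1 h'.2.1 (h.2.2.2 b' h'.2.1 h'.2.2.1 (Ne.symm hne))
    (h'.2.2.2 b h.2.1 h.2.2.1 hne)

theorem Candidate.unique {I : Market A B} {s : GSState A B} {a : A} {b b' : B}
    (h : I.Candidate s b a) (h' : I.Candidate s b' a) : b = b' := by
  rcases h with h | h <;> rcases h' with h' | h'
  · exact Option.some_injective _ (h.symm.trans h')
  · exact absurd (h.symm.trans h'.1) (by simp)
  · exact absurd (h'.symm.trans h.1) (by simp)
  · exact h.unique h'

theorem exists_proposes [Finite B] {I : Market A B} {s : GSState A B} {a : A} {b : B}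
    (h : s.held a = none) (hb : I.adj a b) (hn : ¬ s.applied a b) : ∃ b', I.Proposes s a b' := by
  obtain ⟨b', hb', hmax⟩ := exists_rel_all (S := {b | I.adj a b ∧ ¬ s.applied a b}) (r := I.gtA a)
    (fun x hx => I.gtA_irrefl a x hx.1)
    (fun x hx y hy z hz => I.gtA_trans a x y z hx.1 hy.1 hz.1)
    (fun x hx y hy => I.gtA_total a x y hx.1 hy.1) ⟨b, hb, hn⟩
  exact ⟨b', h, hb'.1, hb'.2, fun c hc hc' => hmax c ⟨hc, hc'⟩⟩

theorem exists_gsStep (I : Market A B) (s : GSState A B) (h : ∃ a b, I.Proposes s a b) :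
    ∃ t, I.GSStep s t := by
  classical
  refine ⟨⟨fun a b => s.applied a b ∨ I.Proposes s a b,
    fun a => if h : ∃ b, I.Accepts s b a then some h.choose else none⟩, h, fun _ _ => Iff.rfl, ?_⟩
  intro a b
  by_cases hx : ∃ b, I.Accepts s b a
  · simp only [hx, dif_pos, Option.some.injEq]
    constructor
    · rintro rfl; exact hx.choose_spec
    · exact fun hb => hx.choose_spec.1.unique hb.1
  · simp only [hx, dif_neg, not_false_eq_true, reduceCtorEq, false_iff]
    exact fun hb => hx ⟨b, hb⟩

theorem exists_gs_terminal [Finite A] [Finite B] (I : Market A B) (s : GSState A B) :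
    ∃ t, Relation.ReflTransGen I.GSStep s t ∧ ¬ ∃ a b, I.Proposes t a b := by
  induction hn : {p : A × B | ¬ s.applied p.1 p.2}.ncard using Nat.strong_induction_on
    generalizing s with
  | _ n ih =>
    by_cases h : ∃ a b, I.Proposes s a b
    · obtain ⟨t, ht⟩ := I.exists_gsStep s h
      obtain ⟨a, b, hab⟩ := h
      have hlt : {p : A × B | ¬ t.applied p.1 p.2}.ncard < n := by
        rw [← hn]
        refine Set.ncard_lt_ncard ⟨fun p hp hs => hp ((ht.2.1 _ _).2 (Or.inl hs)), fun hs => ?_⟩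
          (Set.toFinite _)
        exact hs (show (a, b) ∈ {p : A × B | ¬ s.applied p.1 p.2} from hab.2.2.1)
          ((ht.2.1 a b).2 (Or.inr hab))
      obtain ⟨u, hu, hu'⟩ := ih _ hlt t rfl
      exact ⟨u, hu.head ht, hu'⟩
    · exact ⟨s, .refl, h⟩

theorem exists_gsOutput [Finite A] [Finite B] (I : Market A B) : ∃ M, I.GSOutput M := by
  obtain ⟨t, ht, ht'⟩ := I.exists_gs_terminal ⟨fun _ _ => False, fun _ => none⟩
  exact ⟨t.held, t, ht, ht', rfl⟩

theorem GSInvariant.initial (I : Market A B) :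
    I.GSInvariant ⟨fun _ _ => False, fun _ => none⟩ where
  adj _ _ h := h.elim
  held _ _ h := by simp at h
  upward _ _ _ h := h.elim
  quota b := by simp
  rejected _ _ h := h.elim
  achievable _ _ _ _ h := h.elim

theorem GSInvariant.candidate_adj {I : Market A B} {s : GSState A B} (hs : I.GSInvariant s)
    {a : A} {b : B} (h : I.Candidate s b a) : I.adj a b := by
  rcases h with h | h
  · exact hs.adj a b (hs.held a b h)
  · exact h.2.1

theorem GSInvariant.not_accepts [Finite A] {I : Market A B} {s : GSState A B}
    (hs : I.GSInvariant s) {a : A} {b : B} (h : I.Candidate s b a) (ha : ¬ I.Accepts s b a) :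
    I.quota b ≤ {a' | I.Accepts s b a'}.ncard ∧ ∀ a', I.Accepts s b a' → I.gtB b a' a := by
  have hi : ∀ x ∈ {x | I.Candidate s b x}, ¬ I.gtB b x x :=
    fun x hx => I.gtB_irrefl b x (hs.candidate_adj hx)
  have ht : ∀ x ∈ {x | I.Candidate s b x}, ∀ y ∈ {x | I.Candidate s b x},
      ∀ z ∈ {x | I.Candidate s b x}, I.gtB b x y → I.gtB b y z → I.gtB b x z :=
    fun x hx y hy z hz => I.gtB_trans b x y z (hs.candidate_adj hx) (hs.candidate_adj hy)
      (hs.candidate_adj hz)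
  have htot : ∀ x ∈ {x | I.Candidate s b x}, ∀ y ∈ {x | I.Candidate s b x}, x ≠ y →
      I.gtB b x y ∨ I.gtB b y x :=
    fun x hx y hy => I.gtB_total b x y (hs.candidate_adj hx) (hs.candidate_adj hy)
  have hq : I.quota b ≤ {a' | I.Candidate s b a' ∧ I.gtB b a' a}.ncard :=
    not_lt.1 fun hlt => ha ⟨h, hlt⟩
  refine ⟨le_ncard_best hi ht htot (hq.trans ?_), fun a' ha' => rel_of_not_best hi ht htot h hq
    ha'.1 ha'.2⟩
  exact Set.ncard_le_ncard (fun x hx => hx.1) (Set.toFinite _)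

theorem GSInvariant.step [Finite A] {I : Market A B} {s t : GSState A B} (hs : I.GSInvariant s)
    (hst : I.GSStep s t) : I.GSInvariant t := by
  obtain ⟨-, hap, hheld⟩ := hst
  have hset : ∀ b, {a | t.held a = some b} = {a | I.Accepts s b a} :=
    fun b => Set.ext fun a => hheld a b
  have hcand : ∀ a b, I.Candidate s b a → t.applied a b := by
    rintro a b (h | h)
    · exact (hap a b).2 (Or.inl (hs.held a b h))
    · exact (hap a b).2 (Or.inr h)
  have hi : ∀ b, ∀ x ∈ {x | I.Candidate s b x}, ¬ I.gtB b x x :=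
    fun b x hx => I.gtB_irrefl b x (hs.candidate_adj hx)
  have ht : ∀ b, ∀ x ∈ {x | I.Candidate s b x}, ∀ y ∈ {x | I.Candidate s b x},
      ∀ z ∈ {x | I.Candidate s b x}, I.gtB b x y → I.gtB b y z → I.gtB b x z :=
    fun b x hx y hy z hz => I.gtB_trans b x y z (hs.candidate_adj hx) (hs.candidate_adj hy)
      (hs.candidate_adj hz)
  have htot : ∀ b, ∀ x ∈ {x | I.Candidate s b x}, ∀ y ∈ {x | I.Candidate s b x}, x ≠ y →
      I.gtB b x y ∨ I.gtB b y x :=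
    fun b x hx y hy => I.gtB_total b x y (hs.candidate_adj hx) (hs.candidate_adj hy)
  have hadj : ∀ a b, t.applied a b → I.adj a b := by
    intro a b h
    rcases (hap a b).1 h with h | h
    · exact hs.adj a b h
    · exact h.2.1
  refine ⟨hadj, ?_, ?_, ?_, ?_, ?_⟩
  · exact fun a b h => hcand a b ((hheld a b).1 h).1
  · intro a b b' h hb' hg
    refine (hap a b').2 (Or.inl ?_)
    rcases (hap a b).1 h with h | h
    · exact hs.upward a b b' h hb' hg
    · by_contra hn
      have hne : b' ≠ b := by rintro rfl; exact I.gtA_irrefl a b' hb' hg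
      exact gtA_asymm hb' h.2.1 hg (h.2.2.2 b' hb' hn hne)
  · intro b
    rw [hset]
    exact ncard_best_le (hi b) (ht b) (htot b) (I.quota b)
  · intro a b h hne
    rw [hset]
    have hna : ¬ I.Accepts s b a := fun h' => hne ((hheld a b).2 h')
    by_cases hc : I.Candidate s b a
    · obtain ⟨h₁, h₂⟩ := hs.not_accepts hc hna
      exact ⟨h₁, fun a' ha' => h₂ a' ((hheld a' b).1 ha')⟩
    -- Here `a` was rejected earlier, so a full quota of students held in `s` outranks `a`. An
    -- accepted `x` below `a` would have all of them above it.
    · have hsa : s.applied a b := ((hap a b).1 h).resolve_right fun hp => hc (Or.inr hp)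
      obtain ⟨h₁, h₂⟩ := hs.rejected a b hsa fun hh => hc (Or.inl hh)
      refine ⟨le_ncard_best (hi b) (ht b) (htot b)
        (h₁.trans (Set.ncard_le_ncard (fun x hx => Or.inl hx) (Set.toFinite _))), ?_⟩
      intro x hx
      obtain ⟨hxc, hxq⟩ := (hheld x b).1 hx
      have hxadj := hs.candidate_adj hxc
      have hxa : x ≠ a := by rintro rfl; exact hc hxc
      refine (I.gtB_total b x a hxadj (hadj a b h) hxa).resolve_right fun hlt => ?_
      refine absurd hxq (not_lt.2 (h₁.trans (Set.ncard_le_ncard ?_ (Set.toFinite _))))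
      intro y hy
      have hyc : I.Candidate s b y := Or.inl hy
      exact ⟨hyc, I.gtB_trans b y a x (hs.candidate_adj hyc) (hadj a b h) hxadj (h₂ y hy) hlt⟩
  · intro N hN a b h hNa
    by_contra hne
    have hna : ¬ I.Accepts s b a := fun h' => hne ((hheld a b).2 h')
    have hc : I.Candidate s b a := by
      rcases (hap a b).1 h with h | h
      · exact Or.inl (hs.achievable N hN a b h hNa)
      · exact Or.inr h
    obtain ⟨h₁, h₂⟩ := hs.not_accepts hc hna
    -- At least a full quota is accepted in place of `a`, and `a` occupies a seat of `b` in `N`. So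
    -- some accepted `x` has no seat there, and `x` and `b` will block `N`.
    have hex : ∃ x, I.Accepts s b x ∧ N x ≠ some b := by
      by_contra! hall
      have hss : {x | I.Accepts s b x} ⊂ {x | N x = some b} :=
        ⟨fun x hx => hall x hx, fun hs' => hna (hs' hNa)⟩
      exact absurd (Set.ncard_lt_ncard hss (Set.toFinite _)) (not_lt.2 ((hN.1.2 b).trans h₁))
    obtain ⟨x, hx, hNx⟩ := hex
    have hxadj := hs.candidate_adj hx.1
    -- If `x` preferred its school in `N` to `b`, it would have applied there before `b`, and by
    -- `achievable` it would still be held there.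
    have hw : I.Wants N x b := by
      refine ⟨hxadj, fun b' hb' => ?_⟩
      have hbb : b ≠ b' := by rintro rfl; exact hNx hb'
      have hadj' := hN.1.1 x b' hb'
      refine (I.gtA_total x b b' hxadj hadj' hbb).resolve_right fun hg => ?_
      rcases hx.1 with hh | hp
      · have := hs.achievable N hN x b' (hs.upward x b b' (hs.held x b hh) hadj' hg) hb'
        exact hbb (Option.some_injective _ (hh.symm.trans this))
      · by_cases hb'' : s.applied x b'
        · have := hs.achievable N hN x b' hb'' hb'
          exact absurd (hp.1.symm.trans this) (by simp)
        · exact gtA_asymm hadj' hxadj hg (hp.2.2.2 b' hadj' hb'' hbb.symm)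
    exact gtB_asymm hxadj (hadj a b h) (h₂ x hx) ((hN.2 x b hw).2 a hNa)

theorem GSInvariant.of_reflTransGen [Finite A] {I : Market A B} {s : GSState A B}
    (h : Relation.ReflTransGen I.GSStep ⟨fun _ _ => False, fun _ => none⟩ s) :
    I.GSInvariant s := by
  induction h with
  | refl => exact .initial I
  | tail _ hst ih => exact ih.step hst

theorem GSOutput.isOptimal [Finite A] [Finite B] {I : Market A B} {M : A → Option B}
    (h : I.GSOutput M) : I.IsOptimal M := by
  obtain ⟨s, hs, hterm, rfl⟩ := h
  have hinv := GSInvariant.of_reflTransGen hs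
  have happ : ∀ a b, I.adj a b → s.held a = none → s.applied a b := by
    intro a b hab hn
    by_contra hap
    exact hterm ⟨a, exists_proposes hn hab hap⟩
  have hgt : ∀ a b b', s.held a = some b' → I.adj a b → I.gtA a b b' → s.applied a b :=
    fun a b b' hb' hab hg => hinv.upward a b' b (hinv.held a b' hb') hab hg
  refine ⟨⟨⟨fun a b hb => hinv.adj a b (hinv.held a b hb), hinv.quota⟩, fun a b hw => ?_⟩,
    fun N hN a => ?_⟩
  · refine hinv.rejected a b ?_ hw.ne
    rcases hMa : s.held a with _ | b'
    · exact happ a b hw.1 hMa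
    · exact hgt a b b' hMa hw.1 (hw.2 b' hMa)
  · by_cases heq : s.held a = N a
    · exact Or.inl heq
    · right
      have hna : ∀ b, N a = some b → ¬ s.applied a b := fun b hb hap =>
        heq ((hinv.achievable N hN a b hap hb).trans hb.symm)
      rcases hMa : s.held a with _ | b'
      · rcases hNa : N a with _ | b
        · exact absurd (hMa.trans hNa.symm) heq
        · exact absurd (happ a b (hN.1.1 a b hNa) hMa) (hna b hNa)
      · have hb' := hinv.adj a b' (hinv.held a b' hMa)
        refine ⟨b', rfl, hb', fun b hb => ?_⟩
        have hbadj := hN.1.1 a b hb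
        have hne : b' ≠ b := by rintro rfl; exact heq (hMa.trans hb.symm)
        exact (I.gtA_total a b' b hb' hbadj hne).resolve_right fun hg =>
          hna b hb (hgt a b b' hMa hbadj hg)

theorem exists_isOptimal [Finite A] [Finite B] (I : Market A B) : ∃ M, I.IsOptimal M :=
  I.exists_gsOutput.imp fun _ h => h.isOptimal

theorem Stable.isOptimal_of_underdemanded {I : Market A B} {M N : A → Option B}
    (hM : I.Stable M) (h : ∀ b, I.Underdemanded M b) (hN : I.IsOptimal N) : M = N := by
  funext a
  rcases hN.2 M hM a with h₁ | ⟨b, -, hw⟩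
  · exact h₁.symm
  · exact absurd hw (h b a)

/-! ### Dismissals -/

theorem ext_adj {I J : Market A B} (h₁ : I.adj = J.adj) (h₂ : I.gtA = J.gtA) (h₃ : I.gtB = J.gtB)
    (h₄ : I.quota = J.quota) : I = J := by
  cases I; cases J; cases h₁; cases h₂; cases h₃; cases h₄; rfl

/-- This is why a dismissal never deletes an edge of `M`: every student of `b` outranks those who
want `b`. -/
theorem Stable.not_gtB {I : Market A B} {M : A → Option B} (hM : I.Stable M) {a a' : A} {b : B}
    (hw : I.Wants M a b) (ha' : M a' = some b) : a' ≠ a ∧ ¬ I.gtB b a a' := by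
  refine ⟨?_, ?_⟩
  · rintro rfl; exact hw.ne ha'
  · exact gtB_asymm (hM.1.1 a' b ha') hw.1 ((hM.2 a b hw).2 a' ha')

theorem Wants.of_dismiss {I : Market A B} {C : Set A} {M : A → Option B} {a a' : A} {b b' : B}
    (h : (I.dismiss C a b).Wants M a' b') : I.Wants M a' b' := ⟨h.1.1, h.2⟩

theorem Stable.dismiss {I : Market A B} {M : A → Option B} (hM : I.Stable M) (C : Set A) {a : A}
    {b : B} (hw : I.Wants M a b) : (I.dismiss C a b).Stable M := by
  refine ⟨⟨fun a' b' h => ⟨hM.1.1 a' b' h, ?_⟩, hM.1.2⟩, fun a' b' hw' => hM.2 a' b' hw'.of_dismiss⟩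
  rintro ⟨rfl, h'⟩
  obtain ⟨h₁, h₂⟩ := hM.not_gtB hw h
  rcases h' with h' | h'
  · exact h₁ h'
  · exact h₂ h'.2

theorem Settled.dismiss {I : Market A B} {M : A → Option B} {a' : A} (h : I.Settled M a')
    (C : Set A) (a : A) (b : B) : (I.dismiss C a b).Settled M a' :=
  fun b' hb' c hc => h b' hb' c hc.of_dismiss

/-! ### Confluence of settling steps -/

/-- A settled student who wants `b` in some stable assignment is dismissed from `b`. -/
def SettleStep (C : Set A) (I J : Market A B) : Prop :=
  ∃ M a b, I.Stable M ∧ I.Settled M a ∧ I.Wants M a b ∧ J = I.dismiss C a b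

/-- Lets the arbitrary stable witness of a settling step be replaced by the student-optimal
assignment, so that different steps share one witness. -/
theorem wants_of_settled [Finite A] [Finite B] {I : Market A B} {M N : A → Option B} {a : A}
    {b : B} (hM : I.Stable M) (ha : I.Settled M a) (hw : I.Wants M a b) (hN : I.IsOptimal N) :
    I.Settled N a ∧ I.Wants N a b := by
  refine ⟨ha.of_improvedBy hM hN.1.1 (hN.2 M hM), hw.1, ?_⟩
  rw [hM.eq_of_settled hN.1.1 (hN.2 M hM) ha]
  exact hw.2

theorem dismiss_dismiss_comm (I : Market A B) (C : Set A) (a c : A) (b d : B) :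
    (I.dismiss C a b).dismiss C c d = (I.dismiss C c d).dismiss C a b := by
  refine ext_adj ?_ rfl rfl rfl
  funext x y
  simp only [dismiss, remove]
  exact propext and_right_comm

/-- If `c` was removed on account of a nonconsenting `a` above it, everyone below `c` lies below `a`
and is gone as well. -/
theorem dismiss_dismiss_of_removed {I : Market A B} {C : Set A} {a c : A} {b d : B}
    (hab : I.adj a b) (hcd : I.adj c d) (h : ¬ (I.dismiss C a b).adj c d) :
    (I.dismiss C a b).dismiss C c d = I.dismiss C a b := by
  have h' : d = b ∧ (c = a ∨ (a ∉ C ∧ I.gtB b a c)) := by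
    by_contra hn; exact h ⟨hcd, hn⟩
  obtain ⟨rfl, h'⟩ := h'
  refine ext_adj ?_ rfl rfl rfl
  funext x y
  refine propext ⟨fun hx => hx.1, fun hx => ⟨hx, ?_⟩⟩
  rintro ⟨rfl, hxy⟩
  refine hx.2 ⟨rfl, ?_⟩
  rcases h' with rfl | ⟨haC, hac⟩
  · exact hxy
  · rcases hxy with rfl | ⟨-, hcx⟩
    · exact Or.inr ⟨haC, hac⟩
    · exact Or.inr ⟨haC, I.gtB_trans y a c x hab hcd hx.1 hac hcx⟩

theorem settleStep_dismiss {I : Market A B} {C : Set A} {M : A → Option B} {a c : A} {b d : B}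
    (hM : I.Stable M) (hab : I.Wants M a b) (hc : I.Settled M c) (hcd : I.Wants M c d) :
    Relation.ReflGen (SettleStep C) (I.dismiss C a b) ((I.dismiss C a b).dismiss C c d) := by
  by_cases h : (I.dismiss C a b).adj c d
  · exact .single ⟨M, c, d, hM.dismiss C hab, hc.dismiss C a b, ⟨h, hcd.2⟩, rfl⟩
  · rw [dismiss_dismiss_of_removed hab.1 hcd.1 h]

/-- Both steps are witnessed by the optimal `N`, and deletions commute. After either one, the other
is still a step or has become void. -/
theorem SettleStep.confluent [Finite A] [Finite B] {C : Set A} {I J K : Market A B}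
    (hJ : SettleStep C I J) (hK : SettleStep C I K) :
    ∃ L, Relation.ReflGen (SettleStep C) J L ∧ Relation.ReflTransGen (SettleStep C) K L := by
  obtain ⟨N, hN⟩ := I.exists_isOptimal
  obtain ⟨M₁, a, b, hM₁, ha, hab, rfl⟩ := hJ
  obtain ⟨M₂, c, d, hM₂, hc, hcd, rfl⟩ := hK
  obtain ⟨ha, hab⟩ := wants_of_settled hM₁ ha hab hN
  obtain ⟨hc, hcd⟩ := wants_of_settled hM₂ hc hcd hN
  refine ⟨(I.dismiss C a b).dismiss C c d, settleStep_dismiss hN.1 hab hc hcd, ?_⟩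
  rw [dismiss_dismiss_comm]
  exact (settleStep_dismiss hN.1 hcd ha hab).to_reflTransGen

theorem not_settleStep [Finite A] [Finite B] {C : Set A} {I J : Market A B} {M : A → Option B}
    (hM : I.IsOptimal M) (h : ∀ b, I.Underdemanded M b) : ¬ SettleStep C I J := by
  rintro ⟨N, a, b, hN, ha, hab, -⟩
  exact h b a (wants_of_settled hN ha hab hM).2

theorem SettleStep.adj_of_adj {C : Set A} {I J : Market A B}
    (h : Relation.ReflTransGen (SettleStep C) I J) {a : A} {b : B} (hab : J.adj a b) :
    I.adj a b := by
  induction h with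
  | refl => exact hab
  | tail _ hs ih =>
    obtain ⟨M, c, d, -, -, -, rfl⟩ := hs
    exact ih hab.1

theorem SettleStep.quota_eq {C : Set A} {I J : Market A B}
    (h : Relation.ReflTransGen (SettleStep C) I J) : J.quota = I.quota := by
  induction h with
  | refl => rfl
  | tail _ hs ih =>
    obtain ⟨M, c, d, -, -, -, rfl⟩ := hs
    exact ih

theorem SettleStep.gtA_eq {C : Set A} {I J : Market A B}
    (h : Relation.ReflTransGen (SettleStep C) I J) : J.gtA = I.gtA := by
  induction h with
  | refl => rfl
  | tail _ hs ih =>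
    obtain ⟨M, c, d, -, -, -, rfl⟩ := hs
    exact ih

theorem SettleStep.eq_of_terminal [Finite A] [Finite B] {C : Set A} {I J K : Market A B}
    (hJ : Relation.ReflTransGen (SettleStep C) I J) (hK : Relation.ReflTransGen (SettleStep C) I K)
    (hJ' : ∀ L, ¬ SettleStep C J L) (hK' : ∀ L, ¬ SettleStep C K L) : J = K := by
  obtain ⟨L, hJL, hKL⟩ := Relation.church_rosser
    (fun _ _ _ h h' => SettleStep.confluent h h') hJ hK
  rcases hJL.cases_head with rfl | ⟨_, h, -⟩
  · rcases hKL.cases_head with rfl | ⟨_, h, -⟩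
    · rfl
    · exact absurd h (hK' _)
  · exact absurd h (hJ' _)

/-! ### The school-rotation digraph -/

theorem IsS.unique {I : Market A B} {M : A → Option B} {b : B} {a a' : A} (h : I.IsS M b a)
    (h' : I.IsS M b a') : a = a' := by
  by_contra hne
  exact gtB_asymm h.1.2.1 h'.1.2.1 (h.2 a' h'.1.1 h'.1.2 (Ne.symm hne)) (h'.2 a h.1.1 h.1.2 hne)

theorem Wants.exists_isS [Finite A] {I : Market A B} {M : A → Option B} {a : A} {b : B}
    (h : I.Wants M a b) : ∃ a', I.IsS M b a' := by
  obtain ⟨a', ha', hmax⟩ := exists_rel_all (S := {a | I.Wants M a b}) (r := I.gtB b)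
    (fun x hx => I.gtB_irrefl b x hx.1)
    (fun x hx y hy z hz => I.gtB_trans b x y z hx.1 hy.1 hz.1)
    (fun x hx y hy => I.gtB_total b x y hx.1 hy.1) ⟨a, h⟩
  exact ⟨a', ⟨Wants.ne ha', ha'⟩, fun c _ hc hne => hmax c hc hne⟩

theorem underdemanded_of_isSink [Finite A] {I : Market A B} {M : A → Option B} {b : B}
    (h : I.IsSink M (Vertex.school b)) : I.Underdemanded M b := by
  intro a ha
  obtain ⟨a', ha'⟩ := ha.exists_isS
  exact h _ (.out b a' ha')

theorem settled_of_arc [Finite A] {I : Market A B} {M : A → Option B} {a : A} {v : Vertex A B}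
    (h : I.Arc M (Vertex.student a) v) (hv : I.IsSink M v) : I.Settled M a := by
  intro b hb
  cases h with
  | next b' _ h =>
    refine underdemanded_of_isSink ?_
    simpa only [partner, hb] using hv

theorem isS_of_arc {I : Market A B} {M : A → Option B} {a : A} {b : B}
    (h : I.Arc M (Vertex.school b) (Vertex.student a)) : I.IsS M b a := by
  cases h; assumption

theorem eq_of_arc {I : Market A B} {M : A → Option B} {a : A} {b : B}
    (h : I.Arc M (Vertex.student a) (Vertex.school b)) : M a = some b := by
  generalize hv : Vertex.school b = v at h
  cases h with
  | next _ _ _ =>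
    unfold partner at hv
    split at hv
    · rename_i hb; cases hv; exact hb
    · cases hv

theorem isSink_empty (I : Market A B) (M : A → Option B) : I.IsSink M Vertex.empty := by
  intro w h; cases h

/-- If some school is wanted, then there is a path of two arcs into a sink, or a cycle. -/
theorem Wants.exists_sink_or_cycle [Finite A] [Finite B] {I : Market A B} {M : A → Option B}
    {a : A} {b : B} (h : I.Wants M a b) :
    (∃ b a v, I.Arc M (Vertex.school b) (Vertex.student a) ∧ I.Arc M (Vertex.student a) v ∧
      I.IsSink M v) ∨
    ∃ (n : ℕ) (a : Fin (n + 1) → A) (b : Fin (n + 1) → B), I.IsCycle M a b := by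
  by_cases hsink : ∃ b a v, I.Arc M (Vertex.school b) (Vertex.student a) ∧
      I.Arc M (Vertex.student a) v ∧ I.IsSink M v
  · exact Or.inl hsink
  right
  -- Without a path into a sink, following two arcs is a self-map of the finite set of wanted
  -- schools. A periodic orbit of it is the cycle.
  have hnext : ∀ b : {b // ∃ a, I.IsS M b a}, ∃ (a : A) (b' : {b // ∃ a, I.IsS M b a}),
      I.IsS M b a ∧ M a = some b'.1 := by
    rintro ⟨b, a, hab⟩
    rcases hMa : M a with _ | b'
    · refine absurd ⟨b, a, _, .out b a hab, .next b a hab, ?_⟩ hsink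
      simp only [partner, hMa]
      exact I.isSink_empty M
    · refine ⟨a, ⟨b', ?_⟩, hab, hMa⟩
      by_contra hn
      refine hsink ⟨b, a, _, .out b a hab, .next b a hab, ?_⟩
      simp only [partner, hMa]
      rintro w hw
      cases hw with
      | out _ c hc => exact hn ⟨c, hc⟩
  choose s f hs hf using hnext
  obtain ⟨x, hx⟩ : ∃ x, x ∈ Function.periodicPts f := by
    have := Finite.exists_ne_map_eq_of_infinite fun n : ℕ => f^[n] ⟨b, h.exists_isS⟩
    obtain ⟨m, n, hmn, heq⟩ := this
    wlog hlt : m < n generalizing m n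
    · exact this n m hmn.symm heq.symm (by omega)
    refine ⟨f^[m] ⟨b, h.exists_isS⟩, n - m, by omega, ?_⟩
    have : f^[n - m] (f^[m] ⟨b, h.exists_isS⟩) = f^[m] ⟨b, h.exists_isS⟩ := by
      rw [← Function.iterate_add_apply, Nat.sub_add_cancel hlt.le]
      exact heq.symm
    exact this
  obtain ⟨n, hn⟩ : ∃ n, Function.minimalPeriod f x = n + 1 :=
    Nat.exists_eq_succ_of_ne_zero (Function.minimalPeriod_pos_of_mem_periodicPts hx).ne'
  set y : Fin (n + 1) → {b // ∃ a, I.IsS M b a} := fun i => f^[i] x with hy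
  have hyinj : Function.Injective y := by
    intro i j hij
    have := Function.iterate_injOn_Iio_minimalPeriod (f := f) (x := x)
      (show (i : ℕ) ∈ Set.Iio _ by rw [hn]; exact i.2)
      (show (j : ℕ) ∈ Set.Iio _ by rw [hn]; exact j.2) hij
    exact Fin.ext this
  have hsucc : ∀ i, f (y i) = y (i + 1) := by
    intro i
    have h₁ : f (y i) = f^[(i : ℕ) + 1] x := (Function.iterate_succ_apply' f i x).symm
    rw [h₁, ← Function.iterate_mod_minimalPeriod_eq, hn, hy]
    simp only [Fin.val_add, Fin.val_one', Nat.add_mod_mod]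
  have hM : ∀ i, M (s (y i)) = some (y (i + 1) : B) := fun i => by rw [hf, hsucc]
  -- The shift makes `y i` the current school of the `i`-th student; injectivity of the students
  -- then follows from that of the schools.
  refine ⟨n, fun i => s (y (i - 1)), fun i => y i, ?_, ?_, fun i => ⟨?_, ?_⟩⟩
  · intro i j hij
    have h₁ := hM (i - 1)
    have h₂ := hM (j - 1)
    simp only at hij
    rw [hij, h₂, sub_add_cancel, sub_add_cancel] at h₁
    exact (hyinj (Subtype.ext (Option.some_injective _ h₁))).symm
  · exact Subtype.val_injective.comp hyinj
  · simp only [add_sub_cancel_right]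
    exact .out _ _ (hs _)
  · have h₁ := Arc.next (I := I) _ _ (hs (y (i - 1)))
    rwa [partner, hM, sub_add_cancel] at h₁

/-! ### Elimination of rotations -/

theorem IsElimination.improvedBy {I : Market A B} {M M' : A → Option B} {n : ℕ}
    {a : Fin (n + 1) → A} {b : Fin (n + 1) → B} (hc : I.IsCycle M a b)
    (he : IsElimination M M' a b) : I.ImprovedBy M M' := by
  intro x
  by_cases hx : x ∈ Set.range a
  · obtain ⟨i, rfl⟩ := hx
    right
    have h := (isS_of_arc (hc.2.2 (i - 1)).1).1.2
    have h' := he.1 (i - 1)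
    rw [sub_add_cancel] at h h'
    exact ⟨_, h', h⟩
  · exact Or.inl (he.2 x hx)

theorem IsElimination.stable [Finite A] {I : Market A B} {M M' : A → Option B} {n : ℕ}
    {a : Fin (n + 1) → A} {b : Fin (n + 1) → B} (hM : I.Stable M) (hc : I.IsCycle M a b)
    (he : IsElimination M M' a b) : I.Stable M' := by
  have himp := he.improvedBy hc
  -- `M'` is `M` composed with the permutation sending `a i` to `a (i - 1)`, so school sizes do not
  -- change.
  set σ : Equiv.Perm A := Equiv.Perm.viaEmbedding (Equiv.subRight (1 : Fin (n + 1))) ⟨a, hc.1⟩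
    with hσ
  have hMσ : ∀ x, M' x = M (σ x) := by
    intro x
    by_cases hx : x ∈ Set.range a
    · obtain ⟨i, rfl⟩ := hx
      have h₁ : σ (a i) = a (i - 1) :=
        Equiv.Perm.viaEmbedding_apply (Equiv.subRight (1 : Fin (n + 1))) ⟨a, hc.1⟩ i
      have h₂ := he.1 (i - 1)
      rw [sub_add_cancel] at h₂
      rw [h₁, h₂, eq_of_arc (hc.2.2 (i - 1)).2]
    · have h₁ : σ x = x := Equiv.Perm.viaEmbedding_apply_of_notMem _ ⟨a, hc.1⟩ x hx
      rw [h₁, he.2 x hx]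
  have hcard : ∀ c, {x | M' x = some c}.ncard = {x | M x = some c}.ncard := by
    intro c
    have h₁ : {x | M' x = some c} = σ ⁻¹' {x | M x = some c} := by
      ext x; simp [hMσ]
    rw [h₁, ← σ.image_symm_eq_preimage, Set.ncard_image_of_injective _ σ.symm.injective]
  refine ⟨⟨fun x c hx => ?_, fun c => (hcard c).trans_le (hM.1.2 c)⟩, fun x c hx => ?_⟩
  · rcases himp x with h | ⟨d, hd, hw⟩
    · exact hM.1.1 x c (h.symm.trans hx)
    · obtain rfl : d = c := Option.some_injective _ (hd.symm.trans hx)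
      exact hw.1
  · have hx' := himp.wants hM.1 hx
    obtain ⟨h₁, h₂⟩ := hM.2 x c hx'
    refine ⟨h₁.trans (hcard c).ge, fun y hy => ?_⟩
    -- A student moved to `c` was the first among those wanting `c` at `M`, and `x` is one of these.
    -- The others were at `c` already and outrank `x` by stability of `M`.
    by_cases hyr : y ∈ Set.range a
    · obtain ⟨i, rfl⟩ := hyr
      have h₃ := he.1 (i - 1)
      have h₄ := isS_of_arc (hc.2.2 (i - 1)).1
      rw [sub_add_cancel] at h₃ h₄
      obtain rfl : b (i - 1) = c := Option.some_injective _ (h₃.symm.trans hy)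
      refine h₄.2 x hx'.ne hx' ?_
      rintro rfl
      exact hx.ne hy
    · exact h₂ y ((he.2 y hyr).symm.trans hy)

open Classical in
theorem IsCycle.exists_isElimination {I : Market A B} {M : A → Option B} {n : ℕ}
    {a : Fin (n + 1) → A} {b : Fin (n + 1) → B} (hc : I.IsCycle M a b) :
    ∃ M', IsElimination M M' a b := by
  refine ⟨fun x => if h : ∃ i, a (i + 1) = x then some (b h.choose) else M x, fun i => ?_,
    fun x hx => ?_⟩
  · have h : ∃ j, a (j + 1) = a (i + 1) := ⟨i, rfl⟩
    simp only [h, dif_pos]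
    rw [add_right_cancel (hc.1 h.choose_spec)]
  · refine dif_neg ?_
    rintro ⟨i, rfl⟩
    exact hx ⟨_, rfl⟩

theorem IsElimination.exists_wants {I : Market A B} {M M' : A → Option B} {n : ℕ}
    {a : Fin (n + 1) → A} {b : Fin (n + 1) → B} (hc : I.IsCycle M a b)
    (he : IsElimination M M' a b) : ∃ x c, I.Wants M x c ∧ ¬ I.Wants M' x c :=
  ⟨a (0 + 1), b 0, (isS_of_arc (hc.2.2 0).1).1.2, fun h => h.ne (he.1 0)⟩

theorem IsOptimal.not_isCycle [Finite A] {I : Market A B} {M : A → Option B}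
    (hM : I.IsOptimal M) {n : ℕ} {a : Fin (n + 1) → A} {b : Fin (n + 1) → B} :
    ¬ I.IsCycle M a b := by
  intro hc
  obtain ⟨M', he⟩ := hc.exists_isElimination
  obtain ⟨x, c, h, h'⟩ := he.exists_wants hc
  have := (he.improvedBy hc).antisymm hM.1.1 (hM.2 M' (he.stable hM.1 hc))
  exact h' (this ▸ h)

/-! ### School-rotate-remove with consent -/

theorem ncard_wants_lt [Finite A] [Finite B] {I J : Market A B} {M N : A → Option B}
    (h : ∀ a b, J.Wants N a b → I.Wants M a b) {a : A} {b : B} (hw : I.Wants M a b)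
    (hw' : ¬ J.Wants N a b) :
    {p : A × B | J.Wants N p.1 p.2}.ncard < {p : A × B | I.Wants M p.1 p.2}.ncard :=
  Set.ncard_lt_ncard ⟨fun p hp => h p.1 p.2 hp,
    fun hs => hw' (hs (show (a, b) ∈ {p : A × B | I.Wants M p.1 p.2} from hw))⟩ (Set.toFinite _)

theorem not_wants_dismiss (I : Market A B) (C : Set A) (M : A → Option B) (a : A) (b : B) :
    ¬ (I.dismiss C a b).Wants M a b := fun h => h.1.2 ⟨rfl, Or.inl rfl⟩

/-- The wanting pairs serve as potential: a dismissal destroys one by deleting its edge, a rotation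
by fulfilling the wish. -/
theorem RRRStep.progress [Finite A] [Finite B] {C : Set A} {s t : Market A B × (A → Option B)}
    (h : RRRStep C s t) (hs : s.1.Stable s.2) :
    t.1.Stable t.2 ∧ Relation.ReflTransGen (SettleStep C) s.1 t.1 ∧
      {p : A × B | t.1.Wants t.2 p.1 p.2}.ncard < {p : A × B | s.1.Wants s.2 p.1 p.2}.ncard := by
  cases h with
  | sink I M b a v h₁ h₂ h₃ =>
    have hw := (isS_of_arc h₁).1.2
    exact ⟨hs.dismiss C hw, .single ⟨M, a, b, hs, settled_of_arc h₂ h₃, hw, rfl⟩,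
      ncard_wants_lt (fun _ _ h => h.of_dismiss) hw (I.not_wants_dismiss C M a b)⟩
  | rotation I M M' n a b h₁ h₂ =>
    obtain ⟨x, c, h, h'⟩ := h₂.exists_wants h₁
    exact ⟨h₂.stable hs h₁, .refl,
      ncard_wants_lt (fun _ _ hw => (h₂.improvedBy h₁).wants hs.1 hw) h h'⟩

theorem RRRStep.stable_of_reflTransGen [Finite A] [Finite B] {C : Set A}
    {s t : Market A B × (A → Option B)} (h : Relation.ReflTransGen (RRRStep C) s t)
    (hs : s.1.Stable s.2) :
    t.1.Stable t.2 ∧ Relation.ReflTransGen (SettleStep C) s.1 t.1 := by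
  induction h with
  | refl => exact ⟨hs, .refl⟩
  | tail _ hst ih =>
    obtain ⟨h₁, h₂, -⟩ := hst.progress ih.1
    exact ⟨h₁, ih.2.trans h₂⟩

theorem not_strictAnti_nat (f : ℕ → ℕ) : ¬ ∀ n, f (n + 1) < f n := fun h =>
  (RelEmbedding.natGT (r := (· < ·)) f h).not_wellFounded wellFounded_lt

theorem Stable.rrr_everyExecutionOutputs [Finite A] [Finite B] {I J : Market A B} {C : Set A}
    {M N : A → Option B} (hM : I.Stable M) (hIJ : Relation.ReflTransGen (SettleStep C) I J)
    (hJ : ∀ L, ¬ SettleStep C J L) (hN : J.IsOptimal N) :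
    EveryExecutionOutputs (RRRStep C) RRRHaltsWith (I, M) N := by
  refine ⟨?_, fun s hs hterm => ?_⟩
  · rintro ⟨f, hf₀, hf⟩
    have hst : ∀ n, (f n).1.Stable (f n).2 := by
      intro n
      induction n with
      | zero => rw [hf₀]; exact hM
      | succ n ih => exact ((hf n).progress ih).1
    exact not_strictAnti_nat
      (fun n => {p : A × B | (f n).1.Wants (f n).2 p.1 p.2}.ncard) fun n => ((hf n).progress (hst n)).2.2
  · obtain ⟨K, M'⟩ := s
    obtain ⟨hM', hIK⟩ := RRRStep.stable_of_reflTransGen hs hM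
    simp only at hM' hIK
    have hund : ∀ b, K.Underdemanded M' b := by
      intro b a hw
      rcases hw.exists_sink_or_cycle with ⟨b, a, v, h₁, h₂, h₃⟩ | ⟨n, a, b, hc⟩
      · exact hterm _ (.sink K M' b a v h₁ h₂ h₃)
      · obtain ⟨M'', he⟩ := hc.exists_isElimination
        exact hterm _ (.rotation K M' M'' n a b hc he)
    obtain ⟨M₀, hM₀⟩ := K.exists_isOptimal
    obtain rfl := hM'.isOptimal_of_underdemanded hund hM₀
    -- Any move could be witnessed by the optimal assignment, at which nobody wants anything; so `K`
    -- is terminal.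
    obtain rfl := SettleStep.eq_of_terminal hIK hIJ (fun _ => not_settleStep hM₀ hund) hJ
    refine ⟨fun v w h => ?_, hM₀.eq hN⟩
    cases h with
    | out b a h => exact hund b a h.1.2
    | next b a h => exact hund b a h.1.2

/-! ### Simplified EADAM -/

/-- What the inner loops of a round of simplified EADAM preserve: `H` arises from `G` by settling
students, `M` is still stable, and the students of `T` are still settled. -/
def RoundInvariant (C : Set A) (M : A → Option B) (T : Set A) (G H : Market A B) : Prop :=
  Relation.ReflTransGen (SettleStep C) G H ∧ H.Stable M ∧ ∀ a ∈ T, H.Settled M a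

theorem RoundInvariant.settlePair {C : Set A} {M : A → Option B} {T : Set A} {G H : Market A B}
    (h : RoundInvariant C M T G H) {a : A} (ha : a ∈ T) (b : B) :
    RoundInvariant C M T G (settlePair C M a H b) := by
  unfold Market.settlePair
  split
  · rename_i hw
    exact ⟨h.1.tail ⟨M, a, b, h.2.1, h.2.2 a ha, hw, rfl⟩, h.2.1.dismiss C hw,
      fun c hc => (h.2.2 c hc).dismiss C a b⟩
  · exact h

theorem RoundInvariant.foldl {C : Set A} {M : A → Option B} {T : Set A} {G : Market A B} {a : A}
    (ha : a ∈ T) (bs : List B) {H : Market A B} (h : RoundInvariant C M T G H) :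
    RoundInvariant C M T G (bs.foldl (Market.settlePair C M a) H) := by
  induction bs generalizing H with
  | nil => exact h
  | cons b bs ih => exact ih (h.settlePair ha b)

theorem RoundInvariant.settle {C : Set A} {M : A → Option B} {T : Set A} {G : Market A B}
    (as : List A) (has : ∀ a ∈ as, a ∈ T) (bs : A → List B) {H : Market A B}
    (h : RoundInvariant C M T G H) : RoundInvariant C M T G (settle C M as bs H) := by
  unfold Market.settle
  induction as generalizing H with
  | nil => exact h
  | cons a as ih =>
    exact ih (fun c hc => has c (by simp [hc])) (h.foldl (has a (by simp)) (bs a))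

theorem Wants.of_settlePair {C : Set A} {M : A → Option B} {G : Market A B} {a x : A} {b y : B}
    (h : (Market.settlePair C M a G b).Wants M x y) : G.Wants M x y := by
  unfold Market.settlePair at h
  split at h
  · exact h.of_dismiss
  · exact h

theorem not_wants_settlePair (C : Set A) (M : A → Option B) (G : Market A B) (a : A) (b : B) :
    ¬ (settlePair C M a G b).Wants M a b := by
  intro h
  have hw := h.of_settlePair
  rw [settlePair, if_pos hw] at h
  exact G.not_wants_dismiss C M a b h

theorem Wants.of_foldl {C : Set A} {M : A → Option B} {a x : A} {y : B} (bs : List B)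
    {G : Market A B} (h : (bs.foldl (settlePair C M a) G).Wants M x y) :
    G.Wants M x y ∧ (a = x → y ∉ bs) := by
  induction bs generalizing G with
  | nil => exact ⟨h, by simp⟩
  | cons b bs ih =>
    obtain ⟨h₁, h₂⟩ := ih h
    refine ⟨h₁.of_settlePair, ?_⟩
    rintro rfl hmem
    rcases List.mem_cons.1 hmem with rfl | hmem
    · exact not_wants_settlePair C M G a y h₁
    · exact h₂ rfl hmem

theorem Wants.of_settle {C : Set A} {M : A → Option B} {x : A} {y : B} (as : List A)
    {bs : A → List B} (hbs : ∀ a b, b ∈ bs a) {G : Market A B}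
    (h : (settle C M as bs G).Wants M x y) : G.Wants M x y ∧ x ∉ as := by
  unfold settle at h
  induction as generalizing G with
  | nil => exact ⟨h, by simp⟩
  | cons a as ih =>
    obtain ⟨h₁, h₂⟩ := ih h
    obtain ⟨h₃, h₄⟩ := Wants.of_foldl (bs a) h₁
    refine ⟨h₃, fun hmem => ?_⟩
    rcases List.mem_cons.1 hmem with rfl | hmem
    · exact h₄ rfl (hbs x y)
    · exact h₂ hmem

theorem settled_of_mem {I : Market A B} {M : A → Option B} {a : A}
    (h : a ∈ I.assignedUnderdemandedOrEmpty M) : I.Settled M a := by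
  intro b hb
  rcases h with ⟨b', hb', hu⟩ | h
  · obtain rfl : b' = b := Option.some_injective _ (hb'.symm.trans hb)
    exact hu
  · exact absurd (hb.symm.trans h) (by simp)

theorem mem_of_settled {I : Market A B} {M : A → Option B} {a : A} (h : I.Settled M a) :
    a ∈ I.assignedUnderdemandedOrEmpty M := by
  rcases hMa : M a with _ | b
  · exact Or.inr hMa
  · exact Or.inl ⟨b, hMa, h b hMa⟩

theorem SEADAMStep.reflTransGen_settleStep [Finite A] [Finite B]
    {T : Market A B → (A → Option B) → Set A} {C : Set A} {G H : Market A B}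
    (hT : ∀ G M, T G M ⊆ assignedUnderdemandedOrEmpty G M) (h : SEADAMStep T C G H) :
    Relation.ReflTransGen (SettleStep C) G H := by
  obtain ⟨M, as, bs, hM, -, -, has, -, rfl⟩ := h
  exact (RoundInvariant.settle (C := C) (M := M) (T := T G M) as (fun a ha => (has a).1 ha) bs
    ⟨.refl, hM.isOptimal.1, fun a ha => settled_of_mem (hT G M ha)⟩).1

/-- A Gale–Shapley assignment has no cycle, so a wanted school yields a path into a sink and thus a
settled student wanting some school. The round deletes that edge. The sink may be `∅`, so unassigned
students must be processed. -/
theorem SEADAMStep.ncard_lt [Finite A] [Finite B] {C : Set A} {G H : Market A B}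
    (h : SEADAMStep assignedUnderdemandedOrEmpty C G H) :
    {p : A × B | H.adj p.1 p.2}.ncard < {p : A × B | G.adj p.1 p.2}.ncard := by
  have hGH := h.reflTransGen_settleStep fun _ _ => subset_rfl
  obtain ⟨M, as, bs, hM, ⟨b, hb⟩, -, has, hbs, rfl⟩ := h
  obtain ⟨a, hab⟩ : ∃ a, G.Wants M a b := by simpa [Underdemanded] using hb
  rcases hab.exists_sink_or_cycle with ⟨c, x, v, h₁, h₂, h₃⟩ | ⟨n, a, b, hc⟩
  · have hw := (isS_of_arc h₁).1.2
    refine Set.ncard_lt_ncard ⟨fun p hp => SettleStep.adj_of_adj hGH hp, fun hs => ?_⟩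
      (Set.toFinite _)
    have hadj := hs (show (x, c) ∈ {p : A × B | G.adj p.1 p.2} from hw.1)
    have hgt : (settle C M as bs G).gtA = G.gtA := SettleStep.gtA_eq hGH
    have hw' : (settle C M as bs G).Wants M x c := ⟨hadj, by rw [hgt]; exact hw.2⟩
    exact (hw'.of_settle as fun a b => (hbs a).2 b).2
      ((has x).2 (mem_of_settled (settled_of_arc h₂ h₃)))
  · exact absurd hc hM.isOptimal.not_isCycle

theorem exists_seadamStep [Finite A] [Finite B] (C : Set A) {G : Market A B} {M : A → Option B}
    (hM : G.GSOutput M) (h : ∃ b, ¬ G.Underdemanded M b) :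
    ∃ H, SEADAMStep assignedUnderdemandedOrEmpty C G H := by
  have := Fintype.ofFinite B
  refine ⟨_, M, (Set.toFinite (G.assignedUnderdemandedOrEmpty M)).toFinset.toList,
    fun _ => Finset.univ.toList, hM, h, Finset.nodup_toList _, fun a => ?_,
    fun _ => ⟨Finset.nodup_toList _, fun b => ?_⟩, rfl⟩
  · simp
  · simp

theorem SEADAMHaltsWith.eq [Finite A] [Finite B] {C : Set A} {I J K : Market A B}
    {M N : A → Option B} (hM : SEADAMHaltsWith J M)
    (hIJ : Relation.ReflTransGen (SettleStep C) I J)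
    (hIK : Relation.ReflTransGen (SettleStep C) I K) (hK : ∀ L, ¬ SettleStep C K L)
    (hN : K.IsOptimal N) : M = N := by
  have hopt := hM.1.isOptimal
  obtain rfl := SettleStep.eq_of_terminal hIJ hIK (fun _ => not_settleStep hopt hM.2) hK
  exact hopt.eq hN

theorem reflTransGen_settleStep_of_seadam [Finite A] [Finite B]
    {T : Market A B → (A → Option B) → Set A} {C : Set A} {G H : Market A B}
    (hT : ∀ G M, T G M ⊆ assignedUnderdemandedOrEmpty G M)
    (h : Relation.ReflTransGen (SEADAMStep T C) G H) :
    Relation.ReflTransGen (SettleStep C) G H := by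
  induction h with
  | refl => exact .refl
  | tail _ hs ih => exact ih.trans (hs.reflTransGen_settleStep hT)

theorem seadamOutputs [Finite A] [Finite B] {C : Set A} {I J : Market A B}
    {N : A → Option B} (hIJ : Relation.ReflTransGen (SettleStep C) I J)
    (hJ : ∀ L, ¬ SettleStep C J L) (hN : J.IsOptimal N) : I.SEADAMOutputs C N := by
  refine ⟨?_, fun G hG hterm => ?_⟩
  · rintro ⟨f, -, hf⟩
    exact not_strictAnti_nat
      (fun n => {p : A × B | (f n).adj p.1 p.2}.ncard) fun n => (hf n).ncard_lt
  · obtain ⟨M, hM⟩ := G.exists_gsOutput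
    have hund : ∀ b, G.Underdemanded M b := by
      by_contra! hb
      obtain ⟨H, hH⟩ := exists_seadamStep C hM hb
      exact hterm H hH
    have hhalt : SEADAMHaltsWith G M := ⟨hM, hund⟩
    obtain rfl := hhalt.eq (reflTransGen_settleStep_of_seadam (fun _ _ => subset_rfl) hG) hIJ hJ hN
    exact hhalt

/-! ### The terminal graph and the conclusion -/

/-- Settling steps cannot be continued forever. -/
theorem exists_settle_terminal [Finite A] [Finite B] (C : Set A) (I : Market A B) :
    ∃ J, Relation.ReflTransGen (SettleStep C) I J ∧ ∀ L, ¬ SettleStep C J L := by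
  induction hn : {p : A × B | I.adj p.1 p.2}.ncard using Nat.strong_induction_on
    generalizing I with
  | _ n ih =>
    by_cases h : ∃ L, SettleStep C I L
    · obtain ⟨L, hL⟩ := h
      have hlt : {p : A × B | L.adj p.1 p.2}.ncard < n := by
        rw [← hn]
        obtain ⟨M, a, b, -, -, hw, rfl⟩ := hL
        refine Set.ncard_lt_ncard ⟨fun p hp => hp.1, fun hs => ?_⟩ (Set.toFinite _)
        exact (hs (show (a, b) ∈ {p : A × B | I.adj p.1 p.2} from hw.1)).2 ⟨rfl, Or.inl rfl⟩
      obtain ⟨J, hJ, hJ'⟩ := ih _ hlt L rfl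
      exact ⟨J, hJ.head hL, hJ'⟩
    · exact ⟨I, .refl, fun L hL => h ⟨L, hL⟩⟩

end Market

end SchoolChoice

theorem theoremE9 {A B : Type*} [Finite A] [Finite B] (I : SchoolChoice.Market A B)
    (C : Set A) :
    ∃ M : A → Option B, I.IsAssignment M ∧ I.RRROutputs C M ∧ I.SEADAMOutputs C M ∧
      ∀ N : A → Option B, I.NarrowSEADAMHaltsWith C N → N = M := by
  open SchoolChoice Market in
  obtain ⟨J, hIJ, hJ⟩ := exists_settle_terminal C I
  obtain ⟨M, hM⟩ := J.exists_isOptimal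
  refine ⟨M, ⟨fun a b h => SettleStep.adj_of_adj hIJ (hM.1.1.1 a b h), ?_⟩,
    ⟨I.exists_gsOutput, fun M₀ hM₀ => hM₀.isOptimal.1.rrr_everyExecutionOutputs hIJ hJ hM⟩,
    seadamOutputs hIJ hJ hM, ?_⟩
  · rw [← SettleStep.quota_eq hIJ]
    exact hM.1.1.2
  · rintro N ⟨G, hG, hN⟩
    -- The narrow variant also performs only settling steps, so a halting execution ends in the same
    -- terminal graph.
    exact hN.eq (reflTransGen_settleStep_of_seadam (fun _ _ => Set.subset_union_left) hG) hIJ hJ hM
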